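/- A \emph{dimension function} is a map $h:[0,\infty)\to[0,\infty)$ that is non-decreasing and right-continuous, with $h(0)=0$ and $h(t)>0$ for $t>0$; write $h\prec x^d$ if $\lim_{x\to0^+}x^d/h(x)=0$. For $E\subseteq\mathbb{R}^d$ let $$\mathcal{H}^h(E)=\lim_{\delta\to0^+}\inf\Big\{\sum_{i\in\mathbb{N}}h(|U_i|)\;:\;E\subseteq\bigcup_{i\in\mathbb{N}}U_i,\ 0<|U_i|\le\delta\text{ for all } i\Big\},$$ where $|U|$ is the diameter of $U$. Let $d\ge1$ and let $h$ be a dimension function. Consider the following two assertions. \textbf{(V)} For every sequence $(\psi_k)_{k\in\mathbb{N}}$ of non-zero linear maps $\psi_k:(\mathbb{R}^d)^{m_k}\to\mathbb{R}^{N_k}$, where $m_k\ge2$, there is a compact set $E\subseteq\mathbb{R}^d$ such that $\mathcal{H}^h(E)>0$ and $\psi_k(x_1,\dots,x_{m_k})\ne0$ for all $k\in\mathbb{N}$ and all distinct $x_1,\dots,x_{m_k}\in E$. \textbf{(S)} For every sequence $(\psi_k)_{k\in\mathbb{N}}$ of non-zero linear maps $\psi_k:(\mathbb{R}^d)^{m_k}\to\mathbb{R}$,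 where $m_k\ge2$, there is a compact set $E\subseteq\mathbb{R}^d$ such that $\mathcal{H}^h(E)>0$ and $\psi_k(x_1,\dots,x_{m_k})\ne0$ for all $k\in\mathbb{N}$ and all distinct $x_1,\dots,x_{m_k}\in E$. Then: \begin{enumerate} \item if $h\prec x^d$, then (V) holds; \item (V) and (S) are equivalent (for every dimension function $h$, whether or not $h\prec x^d$). \end{enumerate} In particular, if $h\prec x^d$, then (S) holds as well. -/

import Mathlib

open Filter Topology
open scoped NNReal ENNReal

namespace LinearPatterns

/-- Dimension functions `h : [0, ∞) → [0, ∞)`: positive on `(0, ∞)`, zero at `0`, increasing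
(not necessarily strictly) and right-continuous. -/
structure IsDimensionFunction (h : ℝ≥0 → ℝ≥0) : Prop where
  pos : ∀ t, 0 < t → 0 < h t
  zero : h 0 = 0
  mono : Monotone h
  rightCont : ∀ t, ContinuousWithinAt h (Set.Ici t) t

/-- `h₂ ≺ h₁`, that is `h₁ x / h₂ x → 0` as `x → 0⁺`. -/
def Prec (h₂ h₁ : ℝ≥0 → ℝ≥0) : Prop :=
  Tendsto (fun x => h₁ x / h₂ x) (𝓝[>] 0) (𝓝 0)

/-- `U` is a `δ`-covering of `E`: countably many sets of diameter in `(0, δ]` that cover `E`. -/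
def IsDeltaCovering {X : Type*} [MetricSpace X] (δ : ℝ≥0) (U : ℕ → Set X) (E : Set X) : Prop :=
  E ⊆ ⋃ i, U i ∧ ∀ i, 0 < Metric.ediam (U i) ∧ Metric.ediam (U i) ≤ δ

/-- The infimum of `∑ h(|U_i|)` over all `δ`-coverings `(U_i)` of `E`. -/
noncomputable def hausdorffPre {X : Type*} [MetricSpace X] (h : ℝ≥0 → ℝ≥0) (δ : ℝ≥0)
    (E : Set X) : ℝ≥0∞ :=
  ⨅ (U : ℕ → Set X) (_ : IsDeltaCovering δ U E), ∑' i, (h (Metric.ediam (U i)).toNNReal : ℝ≥0∞)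

/-- The outer Hausdorff measure `ℋ^h(E)`. It is the limit of `hausdorffPre h δ E` as `δ → 0⁺`
(see `tendsto_hausdorffPre`), written as a supremum since `hausdorffPre` is antitone in `δ`. -/
noncomputable def hausdorffOuter {X : Type*} [MetricSpace X] (h : ℝ≥0 → ℝ≥0) (E : Set X) : ℝ≥0∞ :=
  ⨆ (δ : ℝ≥0) (_ : 0 < δ), hausdorffPre h δ E

theorem hausdorffPre_antitone {X : Type*} [MetricSpace X] (h : ℝ≥0 → ℝ≥0) (E : Set X) :
    Antitone fun δ => hausdorffPre h δ E := by
  intro δ₁ δ₂ hδ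
  refine le_iInf₂ fun U hU => iInf₂_le U ⟨hU.1, fun i => ⟨(hU.2 i).1, (hU.2 i).2.trans ?_⟩⟩
  exact_mod_cast hδ

theorem tendsto_hausdorffPre {X : Type*} [MetricSpace X] (h : ℝ≥0 → ℝ≥0) (E : Set X) :
    Tendsto (fun δ => hausdorffPre h δ E) (𝓝[>] 0) (𝓝 (hausdorffOuter h E)) := by
  refine tendsto_order.2 ⟨fun a ha => ?_, fun a ha => ?_⟩
  · obtain ⟨δ, hδ⟩ := lt_iSup_iff.1 ha
    obtain ⟨hpos, hδ⟩ := lt_iSup_iff.1 hδ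
    filter_upwards [Ioo_mem_nhdsGT hpos] with ε hε
    exact hδ.trans_le (hausdorffPre_antitone h E hε.2.le)
  · filter_upwards [self_mem_nhdsWithin] with ε hε
    exact lt_of_le_of_lt (le_iSup₂ (f := fun (δ : ℝ≥0) (_ : 0 < δ) => hausdorffPre h δ E) ε hε) ha

/-- `ψ` is a pattern in `E ⊆ ℝ^d`: it vanishes at some tuple of distinct points of `E`. -/
def IsPattern {d m : ℕ} {F : Type*} [Zero F] (ψ : (Fin m → EuclideanSpace ℝ (Fin d)) → F)
    (E : Set (EuclideanSpace ℝ (Fin d))) : Prop :=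
  ∃ x : Fin m → EuclideanSpace ℝ (Fin d), Function.Injective x ∧ (∀ i, x i ∈ E) ∧ ψ x = 0

/-- The conclusion of the main theorem for `d` and `h`, for real-valued linear patterns: every
sequence of non-zero linear functions `ψ_k : (ℝ^d)^{m_k} → ℝ` with `m_k ≥ 2` is avoided by some
compact set of positive `ℋ^h` measure. -/
def ScalarAvoidance (d : ℕ) (h : ℝ≥0 → ℝ≥0) : Prop :=
  ∀ (m : ℕ → ℕ) (ψ : ∀ k, (Fin (m k) → EuclideanSpace ℝ (Fin d)) →ₗ[ℝ] ℝ),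
    (∀ k, 2 ≤ m k) → (∀ k, ψ k ≠ 0) →
      ∃ E : Set (EuclideanSpace ℝ (Fin d)),
        IsCompact E ∧ 0 < hausdorffOuter h E ∧ ∀ k, ¬ IsPattern (ψ k) E

/-- The same conclusion for vector-valued linear patterns `ψ_k : (ℝ^d)^{m_k} → ℝ^{N_k}`. -/
def VectorAvoidance (d : ℕ) (h : ℝ≥0 → ℝ≥0) : Prop :=
  ∀ (m N : ℕ → ℕ)
    (ψ : ∀ k, (Fin (m k) → EuclideanSpace ℝ (Fin d)) →ₗ[ℝ] EuclideanSpace ℝ (Fin (N k))),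
    (∀ k, 2 ≤ m k) → (∀ k, ψ k ≠ 0) →
      ∃ E : Set (EuclideanSpace ℝ (Fin d)),
        IsCompact E ∧ 0 < hausdorffOuter h E ∧ ∀ k, ¬ IsPattern (ψ k) E

end LinearPatterns

/-! Write `ψ x = ∑ i, a i (x i)` with some `a i₀ ≠ 0`. Choose disjoint open sets `B i` and confine
the points of each `B i` to those where `N * a i x` lies within `η` of `s i` modulo 1, with the `s
i` summing to `1/2` and `η` small. A transversal of the `B i` then makes `N * ψ x` close to `1/2`
modulo 1, hence non-zero (`sum_ne_zero_of_mem_gridSet`). A countable basis reduces all tuples of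
distinct points to countably many such constraints.

Each constraint is almost free when `N` is large: by Riemann-Lebesgue it carries bounded weights
converging weakly to 1 (`thinnable_gridSet`). Multiplying a density by such a weight keeps its mass
and its mass on any given finite set of balls almost unchanged. At smaller scales boundedness
suffices, because `h` dominates every multiple of `x ^ d` (`IsSpreadDensity.exists_thinning`).
Iterating gives nested compact sets, and a mass distribution argument bounds `ℋ^h` of their
intersection from below (`hausdorffOuter_pos_of_isSpreadDensity`).

Vector patterns reduce to scalar ones through a non-zero coordinate. -/

namespace LinearPatterns

open MeasureTheory

/-! ### Equidistribution of `N * a x` modulo 1 -/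

section Equidistribution

variable {V : Type*} [NormedAddCommGroup V] [NormedSpace ℝ V] [FiniteDimensional ℝ V]
  [MeasurableSpace V] [BorelSpace V] {μ : Measure V} [μ.IsAddHaarMeasure]

/-- Riemann-Lebesgue along integer multiples of a fixed non-zero functional, for one character. -/
theorem tendsto_integral_mul_fourier {a : V →L[ℝ] ℝ} (ha : a ≠ 0) {φ : V → ℂ} {n : ℤ}
    (hn : n ≠ 0) :
    Tendsto (fun N : ℕ => ∫ x, φ x * fourier n (((N * a x : ℝ)) : UnitAddCircle) ∂μ) atTop
      (𝓝 0) := by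
  -- The integral is the Fourier transform of `φ` at `-N n a`, which escapes to infinity in the
  -- dual.
  have h1 : Tendsto (fun N : ℕ => (N : ℝ) • (-(n : ℝ) • a)) atTop (cocompact (StrongDual ℝ V)) := by
    rw [← Metric.cobounded_eq_cocompact, ← tendsto_norm_atTop_iff_cobounded]
    have : 0 < ‖-(n : ℝ) • a‖ := by
      rw [norm_pos_iff]
      exact smul_ne_zero (neg_ne_zero.2 (Int.cast_ne_zero.2 hn)) ha
    simp_rw [norm_smul (_ : ℝ) (-(n : ℝ) • a), RCLike.norm_natCast]
    exact tendsto_natCast_atTop_atTop.atTop_mul_const this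
  refine ((tendsto_integral_exp_smul_cocompact φ μ).comp h1).congr fun N => ?_
  refine integral_congr_ae (.of_forall fun x => ?_)
  simp only [fourier_coe_apply, Circle.smul_def, Real.fourierChar_apply, smul_eq_mul]
  rw [mul_comm]
  congr 2
  simp
  ring

/-- If `g` is continuous on the circle, then the functions `x ↦ g (N a(x))` converge weakly to the
mean of `g`. -/
theorem tendsto_integral_mul_circle_complex {a : V →L[ℝ] ℝ} (ha : a ≠ 0) {φ : V → ℂ}
    (hφ : Integrable φ μ) (g : C(UnitAddCircle, ℂ)) :
    Tendsto (fun N : ℕ => ∫ x, φ x * g ((N * a x : ℝ) : UnitAddCircle) ∂μ) atTop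
      (𝓝 ((∫ x, φ x ∂μ) * ∫ t, g t ∂AddCircle.haarAddCircle)) := by
  have hmeas : ∀ N : ℕ, Continuous fun x : V => ((N * a x : ℝ) : UnitAddCircle) := fun N =>
    (AddCircle.continuous_mk' 1).comp (continuous_const.mul a.continuous)
  have hint : ∀ (g : C(UnitAddCircle, ℂ)) (N : ℕ),
      Integrable (fun x => φ x * g ((N * a x : ℝ) : UnitAddCircle)) μ := fun g N =>
    hφ.mul_bdd (c := ‖g‖) (g.continuous.comp (hmeas N)).aestronglyMeasurable
      (.of_forall fun x => g.norm_coe_le_norm _)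
  have hgi : ∀ g : C(UnitAddCircle, ℂ), Integrable g AddCircle.haarAddCircle := fun g =>
    g.continuous.integrable_of_hasCompactSupport (HasCompactSupport.of_compactSpace g)
  let P : C(UnitAddCircle, ℂ) → Prop := fun g =>
    Tendsto (fun N : ℕ => ∫ x, φ x * g ((N * a x : ℝ) : UnitAddCircle) ∂μ) atTop
      (𝓝 ((∫ x, φ x ∂μ) * ∫ t, g t ∂AddCircle.haarAddCircle))
  have hspan : ∀ g ∈ Submodule.span ℂ (Set.range (fourier (T := 1))), P g := by
    intro g hg
    induction hg using Submodule.span_induction with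
    | mem g hg =>
      obtain ⟨n, rfl⟩ := hg
      by_cases hn : n = 0
      · subst hn
        simp [P]
      · have h0 : ∫ t, fourier n t ∂(AddCircle.haarAddCircle (T := 1)) = 0 :=
          integral_eq_zero_of_add_right_eq_neg (fourier_add_half_inv_index hn one_pos)
        simp only [P]
        rw [h0, mul_zero]
        exact tendsto_integral_mul_fourier ha hn
    | zero => simp [P]
    | add f g _ _ hf hg =>
      simp only [P, ContinuousMap.add_apply, mul_add] at hf hg ⊢
      rw [integral_add (hgi f) (hgi g), mul_add]
      refine (hf.add hg).congr fun N => ?_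
      rw [integral_add (hint f N) (hint g N)]
    | smul c g _ hg =>
      simp only [P, ContinuousMap.smul_apply, smul_eq_mul, mul_left_comm _ c] at hg ⊢
      simp_rw [integral_const_mul, mul_left_comm _ c]
      exact hg.const_mul c
  -- Trigonometric polynomials are uniformly dense, and both sides are Lipschitz in `g` with
  -- constant `A`, the `L¹` norm of `φ`.
  have hdense : g ∈ closure (Submodule.span ℂ (Set.range (fourier (T := 1))) :
      Set C(UnitAddCircle, ℂ)) := by
    have := span_fourier_closure_eq_top (T := 1)
    rw [← Submodule.topologicalClosure_coe, this]
    trivial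
  set A : ℝ := ∫ x, ‖φ x‖ ∂μ
  have hA : 0 ≤ A := integral_nonneg fun _ => norm_nonneg _
  rw [Metric.tendsto_atTop]
  intro ε hε
  obtain ⟨g', hg', hgg⟩ := Metric.mem_closure_iff.1 hdense (ε / (3 * (A + 1))) (by positivity)
  obtain ⟨N₀, hN₀⟩ := Metric.tendsto_atTop.1 (hspan g' hg') (ε / 3) (by positivity)
  have hb : A * dist g g' ≤ ε / 3 := by
    calc A * dist g g' ≤ (A + 1) * (ε / (3 * (A + 1))) := by gcongr; linarith
      _ = ε / 3 := by field_simp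
  have hsub : ∀ t, ‖g t - g' t‖ ≤ dist g g' := fun t => by
    rw [← dist_eq_norm]; exact ContinuousMap.dist_apply_le_dist t
  have h1 : ∀ N : ℕ, dist (∫ x, φ x * g ((N * a x : ℝ) : UnitAddCircle) ∂μ)
      (∫ x, φ x * g' ((N * a x : ℝ) : UnitAddCircle) ∂μ) ≤ ε / 3 := fun N => by
    rw [dist_eq_norm, ← integral_sub (hint g N) (hint g' N)]
    refine le_trans ?_ hb
    simp only [A]
    rw [← integral_mul_const]
    refine norm_integral_le_of_norm_le (hφ.norm.mul_const _) (.of_forall fun x => ?_)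
    rw [← mul_sub, norm_mul]
    gcongr
    exact hsub _
  have h2 : dist ((∫ x, φ x ∂μ) * ∫ t, g' t ∂AddCircle.haarAddCircle)
      ((∫ x, φ x ∂μ) * ∫ t, g t ∂AddCircle.haarAddCircle) ≤ ε / 3 := by
    rw [dist_eq_norm, ← mul_sub, norm_mul]
    refine le_trans ?_ hb
    gcongr
    · exact norm_integral_le_integral_norm _
    · rw [← integral_sub (hgi g') (hgi g)]
      refine (norm_integral_le_of_norm_le_const (C := dist g g') (.of_forall fun t => ?_)).trans ?_
      · rw [norm_sub_rev]; exact hsub t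
      · simp
  refine ⟨N₀, fun N hN => ?_⟩
  have := dist_triangle4 (∫ x, φ x * g ((N * a x : ℝ) : UnitAddCircle) ∂μ)
    (∫ x, φ x * g' ((N * a x : ℝ) : UnitAddCircle) ∂μ)
    ((∫ x, φ x ∂μ) * ∫ t, g' t ∂AddCircle.haarAddCircle)
    ((∫ x, φ x ∂μ) * ∫ t, g t ∂AddCircle.haarAddCircle)
  linarith [h1 N, hN₀ N hN]

theorem tendsto_integral_mul_circle {a : V →L[ℝ] ℝ} (ha : a ≠ 0) {φ : V → ℝ}
    (hφ : Integrable φ μ) (g : C(UnitAddCircle, ℝ)) :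
    Tendsto (fun N : ℕ => ∫ x, φ x * g ((N * a x : ℝ) : UnitAddCircle) ∂μ) atTop
      (𝓝 ((∫ x, φ x ∂μ) * ∫ t, g t ∂AddCircle.haarAddCircle)) := by
  have := tendsto_integral_mul_circle_complex ha (φ := fun x => (φ x : ℂ)) hφ.ofReal
    ⟨fun t => (g t : ℂ), by fun_prop⟩
  simp only [ContinuousMap.coe_mk, ← Complex.ofReal_mul, integral_complex_ofReal] at this
  exact Complex.continuous_re.continuousAt.tendsto.comp this

/-- A continuous probability density on the circle supported in the ball of radius `η` about `s`. -/
theorem exists_circle_bump (s : UnitAddCircle) {η : ℝ} (hη : 0 < η) :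
    ∃ g : C(UnitAddCircle, ℝ), (∀ t, 0 ≤ g t) ∧ (∀ t, η < ‖t - s‖ → g t = 0) ∧
      ∫ t, g t ∂AddCircle.haarAddCircle = 1 := by
  let u : C(UnitAddCircle, ℝ) := ⟨fun t => max 0 (η - ‖t - s‖), by fun_prop⟩
  have hu : ∀ t, 0 ≤ u t := fun t => le_max_left _ _
  have hpos : 0 < ∫ t, u t ∂AddCircle.haarAddCircle :=
    u.continuous.integral_pos_of_hasCompactSupport_nonneg_nonzero
      (HasCompactSupport.of_compactSpace u) hu (x := s) (by simp [u, hη.ne', hη.le])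
  refine ⟨(∫ t, u t ∂AddCircle.haarAddCircle)⁻¹ • u, fun t => ?_, fun t ht => ?_, ?_⟩
  · exact mul_nonneg (inv_nonneg.2 hpos.le) (hu t)
  · have : u t = 0 := max_eq_left (by linarith)
    simp [this]
  · simp only [ContinuousMap.smul_apply, smul_eq_mul]
    rw [integral_const_mul, inv_mul_cancel₀ hpos.ne']

end Equidistribution

end LinearPatterns

namespace LinearPatterns

open MeasureTheory

/-! ### Grid constraints and their weights -/

section Thinning

variable {V : Type*} [NormedAddCommGroup V] [NormedSpace ℝ V] [FiniteDimensional ℝ V]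
  [MeasurableSpace V] [BorelSpace V]

/-- The sets `T N` carry uniformly bounded densities that converge weakly to `1`. -/
def Thinnable (μ : Measure V) (T : ℕ → Set V) : Prop :=
  ∃ (K : ℝ) (w : ℕ → V → ℝ), (∀ N, Measurable (w N)) ∧ (∀ N x, 0 ≤ w N x) ∧
    (∀ N x, w N x ≤ K) ∧ (∀ N, ∀ x ∉ T N, w N x = 0) ∧
    ∀ φ : V → ℝ, Integrable φ μ →
      Tendsto (fun N => ∫ x, φ x * w N x ∂μ) atTop (𝓝 (∫ x, φ x ∂μ))

/-- Points of `B i` satisfy `N (a i)(x) ∈ s i + [-η, η]` modulo `1`. -/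
def gridSet {ι : Type*} (B : ι → Set V) (a : ι → V →L[ℝ] ℝ) (s : ι → UnitAddCircle) (η : ℝ)
    (N : ℕ) : Set V :=
  {x | ∀ i, x ∈ B i → ‖((N * a i x : ℝ) : UnitAddCircle) - s i‖ ≤ η}

omit [FiniteDimensional ℝ V] [MeasurableSpace V] [BorelSpace V] in
theorem continuous_circle (a : V →L[ℝ] ℝ) (N : ℕ) :
    Continuous fun x : V => ((N * a x : ℝ) : UnitAddCircle) :=
  (AddCircle.continuous_mk' 1).comp (continuous_const.mul a.continuous)

omit [FiniteDimensional ℝ V] [MeasurableSpace V] [BorelSpace V] in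
theorem isClosed_gridSet {ι : Type*} {B : ι → Set V} (hB : ∀ i, IsOpen (B i))
    (a : ι → V →L[ℝ] ℝ) (s : ι → UnitAddCircle) (η : ℝ) (N : ℕ) :
    IsClosed (gridSet B a s η N) := by
  have : gridSet B a s η N =
      ⋂ i, (B i)ᶜ ∪ {x | ‖((N * a i x : ℝ) : UnitAddCircle) - s i‖ ≤ η} := by
    ext x
    simp only [gridSet, Set.mem_ofPred_eq, Set.mem_iInter, Set.mem_union, Set.mem_compl_iff]
    exact forall_congr' fun i => imp_iff_not_or
  rw [this]
  refine isClosed_iInter fun i => (hB i).isClosed_compl.union ?_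
  exact isClosed_le ((continuous_circle (a i) N).sub continuous_const).norm continuous_const

/-- On `B i` the weight is a circle bump of mean 1 evaluated at `N * a i x`, and off all the `B i`
it is 1. Where `a i = 0`, equidistribution fails, but then `s i = 0` makes the constraint void and
the constant 1 serves as the bump. -/
theorem thinnable_gridSet (μ : Measure V) [μ.IsAddHaarMeasure] {ι : Type*} [Fintype ι]
    {B : ι → Set V} (hB : ∀ i, IsOpen (B i)) (hd : Pairwise (Function.onFun Disjoint B))
    {a : ι → V →L[ℝ] ℝ} {s : ι → UnitAddCircle} (hs : ∀ i, a i = 0 → s i = 0) {η : ℝ}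
    (hη : 0 < η) : Thinnable μ (gridSet B a s η) := by
  classical
  have hg : ∀ i, ∃ g : C(UnitAddCircle, ℝ), (∀ t, 0 ≤ g t) ∧
      (a i ≠ 0 → ∀ t, η < ‖t - s i‖ → g t = 0) ∧ (a i = 0 → g = 1) ∧
      ∫ t, g t ∂AddCircle.haarAddCircle = 1 := fun i => by
    by_cases h : a i = 0
    · exact ⟨1, fun _ => zero_le_one, fun h' => absurd h h', fun _ => rfl, by simp⟩
    · obtain ⟨g, h0, h1, h2⟩ := exists_circle_bump (s i) hη
      exact ⟨g, h0, fun _ => h1, fun h' => absurd h' h, h2⟩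
  choose g hg0 hgs hg1 hgi using hg
  -- Deviation of the weight from 1 on `B i`. Disjointness leaves at most one non-zero term in `∑ i,
  -- b i N x`, and each term tends weakly to 0.
  let b : ι → ℕ → V → ℝ := fun i N =>
    (B i).indicator fun x => g i ((N * a i x : ℝ) : UnitAddCircle) - 1
  have hbm : ∀ i N, Measurable (b i N) := fun i N =>
    ((((g i).continuous.comp (continuous_circle (a i) N)).sub
      continuous_const).measurable).indicator (hB i).measurableSet
  have hbb : ∀ i N x, ‖b i N x‖ ≤ ‖g i‖ + 1 := fun i N x => by
    refine (norm_indicator_le_norm_self _ _).trans ((norm_sub_le _ _).trans ?_)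
    gcongr
    · exact (g i).norm_coe_le_norm _
    · simp
  have hmem : ∀ i N, ∀ x ∈ B i, 1 + ∑ j, b j N x = g i ((N * a i x : ℝ) : UnitAddCircle) := by
    intro i N x hx
    rw [Finset.sum_eq_single i]
    · simp [b, hx]
    · intro j _ hj
      exact Set.indicator_of_notMem (fun hj' => Set.disjoint_left.1 (hd hj) hj' hx) _
    · simp
  refine ⟨1 + ∑ i, (‖g i‖ + 1), fun N x => 1 + ∑ i, b i N x, fun N => ?_, fun N x => ?_,
    fun N x => ?_, fun N x hx => ?_, fun φ hφ => ?_⟩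
  · exact measurable_const.add (Finset.measurable_fun_sum _ fun i _ => hbm i N)
  · by_cases h : ∃ i, x ∈ B i
    · obtain ⟨i, hi⟩ := h
      simp only [hmem i N x hi]
      exact hg0 i _
    · push Not at h
      have : ∑ i, b i N x = 0 := Finset.sum_eq_zero fun i _ => Set.indicator_of_notMem (h i) _
      simp [this]
  · refine add_le_add le_rfl (Finset.sum_le_sum fun i _ => ?_)
    exact (le_abs_self _).trans (hbb i N x)
  · simp only [gridSet, Set.mem_ofPred_eq, not_forall, not_le] at hx
    obtain ⟨i, hi, hlt⟩ := hx
    simp only [hmem i N x hi]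
    have ha : a i ≠ 0 := fun h => by
      simp [h, hs i h] at hlt
      linarith
    exact hgs i ha _ hlt
  · have hint : ∀ i N, Integrable (fun x => φ x * b i N x) μ := fun i N =>
      hφ.mul_bdd (hbm i N).aestronglyMeasurable (.of_forall (hbb i N))
    have h0 : ∀ i, Tendsto (fun N => ∫ x, φ x * b i N x ∂μ) atTop (𝓝 0) := fun i => by
      by_cases ha : a i = 0
      · simp [b, hg1 i ha]
      have hφi : Integrable ((B i).indicator φ) μ := hφ.indicator (hB i).measurableSet
      have := (tendsto_integral_mul_circle ha hφi (g i)).sub_const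
        (∫ x, (B i).indicator φ x ∂μ)
      rw [hgi, mul_one, sub_self] at this
      refine this.congr fun N => ?_
      rw [← integral_sub _ hφi]
      · refine integral_congr_ae (.of_forall fun x => ?_)
        by_cases hx : x ∈ B i <;> simp [b, hx, mul_sub]
      · exact hφi.mul_bdd (c := ‖g i‖)
          ((g i).continuous.comp (continuous_circle (a i) N)).aestronglyMeasurable
          (.of_forall fun x => (g i).norm_coe_le_norm _)
    have := (tendsto_finsetSum (Finset.univ : Finset ι) fun i _ => h0 i).const_add (∫ x, φ x ∂μ)
    rw [Finset.sum_const_zero, add_zero] at this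
    refine this.congr fun N => ?_
    simp only [mul_add, mul_one, Finset.mul_sum]
    rw [integral_add hφ (integrable_finsetSum _ fun i _ => hint i N),
      integral_finsetSum _ fun i _ => hint i N]

omit [FiniteDimensional ℝ V] [MeasurableSpace V] [BorelSpace V] in
/-- If the shifts add up to `1 / 2`, then no transversal of the `B i` in the grid set is a zero of
`∑ i, a i (x i)`. -/
theorem sum_ne_zero_of_mem_gridSet {ι : Type*} [Fintype ι] {B : ι → Set V}
    {a : ι → V →L[ℝ] ℝ} {s : ι → UnitAddCircle} {η : ℝ} {N : ℕ}
    (hs : ∑ i, s i = ((1 / 2 : ℝ) : UnitAddCircle)) (hη : Fintype.card ι * η < 1 / 2)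
    {x : ι → V} (hxB : ∀ i, x i ∈ B i) (hx : ∀ i, x i ∈ gridSet B a s η N) :
    ∑ i, a i (x i) ≠ 0 := by
  intro h0
  have h1 : ∑ i, (((N * a i (x i) : ℝ) : UnitAddCircle) - s i) = -((1 / 2 : ℝ) : UnitAddCircle) := by
    rw [Finset.sum_sub_distrib, hs, ← QuotientAddGroup.mk_sum, ← Finset.mul_sum, h0]
    simp
  have h2 := norm_sum_le Finset.univ fun i => (((N * a i (x i) : ℝ) : UnitAddCircle) - s i)
  rw [h1, norm_neg, UnitAddCircle.norm_eq] at h2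
  have h3 : ∑ i, ‖((N * a i (x i) : ℝ) : UnitAddCircle) - s i‖ ≤ ∑ _i : ι, η :=
    Finset.sum_le_sum fun i _ => hx i i (hxB i)
  rw [Finset.sum_const, Finset.card_univ, nsmul_eq_mul] at h3
  -- `1/2` has norm `1/2` on the circle, while the sum of the errors is at most `card ι * η < 1/2`.
  have h4 : |(1 / 2 : ℝ) - round (1 / 2 : ℝ)| = 1 / 2 := by
    norm_num [round_eq]
  linarith

end Thinning

end LinearPatterns

namespace LinearPatterns

open MeasureTheory

/-! ### Iterated thinning and the mass distribution principle -/

section Construction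

variable {V : Type*} [NormedAddCommGroup V] [NormedSpace ℝ V] [FiniteDimensional ℝ V]
  [MeasurableSpace V] [BorelSpace V]

/-- Bounded densities on the unit ball of mass more than half the volume of that ball, and with
mass less than `h (2⁻ⁿ)` on the balls of radius `4 · 2⁻ⁿ` centred at `F n`, for `n ≥ n₀`. -/
structure IsSpreadDensity (μ : Measure V) (h : ℝ≥0 → ℝ≥0) (F : ℕ → Set V) (n₀ : ℕ)
    (f : V → ℝ) : Prop where
  measurable : Measurable f
  nonneg : ∀ x, 0 ≤ f x
  bdd : ∃ M, ∀ x, f x ≤ M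
  support : ∀ x ∉ Metric.closedBall (0 : V) 1, f x = 0
  mass : μ.real (Metric.closedBall (0 : V) 1) / 2 < ∫ x, f x ∂μ
  ball : ∀ n, n₀ ≤ n → ∀ y ∈ F n, ∫ x in Metric.ball y (4 * 2⁻¹ ^ n), f x ∂μ < h (2⁻¹ ^ n)

/-- `h (2⁻ⁿ)` eventually exceeds every multiple of `2⁻ⁿᵈ`. -/
def DominatesPow (h : ℝ≥0 → ℝ≥0) (d : ℕ) : Prop :=
  ∀ C : ℝ, ∀ᶠ n : ℕ in atTop, C * (2⁻¹ ^ n) ^ d < (h (2⁻¹ ^ n) : ℝ)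

theorem DominatesPow.of_prec {h : ℝ≥0 → ℝ≥0} (hpos : ∀ t, 0 < t → 0 < h t) {d : ℕ}
    (hp : Prec h fun x => x ^ d) : DominatesPow h d := by
  intro C
  have hC : (0 : ℝ≥0) < (C.toNNReal + 1)⁻¹ := by positivity
  have hlim : Tendsto (fun n : ℕ => (2⁻¹ : ℝ≥0) ^ n) atTop (𝓝[>] 0) := by
    refine tendsto_nhdsWithin_iff.2 ⟨?_, .of_forall fun n => ?_⟩
    · exact NNReal.tendsto_pow_atTop_nhds_zero_of_lt_one (by norm_num)
    · exact Set.mem_Ioi.2 (pow_pos (by norm_num) n)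
  filter_upwards [(hp.comp hlim).eventually_lt_const hC] with n hn
  have hh : 0 < h (2⁻¹ ^ n) := hpos _ (pow_pos (by norm_num) n)
  have hx : (0 : ℝ≥0) < (2⁻¹ ^ n) ^ d := pow_pos (pow_pos (by norm_num) n) d
  simp only [Function.comp_apply] at hn
  rw [div_lt_iff₀ hh, inv_mul_eq_div, lt_div_iff₀ (by positivity)] at hn
  have hn' : ((2⁻¹ : ℝ) ^ n) ^ d * (C.toNNReal + 1) < h (2⁻¹ ^ n) := by exact_mod_cast hn
  have hx' : (0 : ℝ) < (2⁻¹ ^ n) ^ d := by positivity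
  have hC' : C ≤ C.toNNReal := Real.le_coe_toNNReal C
  nlinarith

variable {μ : Measure V} [μ.IsAddHaarMeasure] {h : ℝ≥0 → ℝ≥0} {F : ℕ → Set V} {n₀ : ℕ}

omit [BorelSpace V] in
theorem integrable_of_bdd_of_support {f : V → ℝ}
    (hm : Measurable f) (h0 : ∀ x, 0 ≤ f x)
    {M : ℝ} (hM : ∀ x, f x ≤ M) (hs : ∀ x ∉ Metric.closedBall (0 : V) 1, f x = 0) :
    Integrable f μ := by
  have : IntegrableOn f (Metric.closedBall (0 : V) 1) μ :=
    Measure.integrableOn_of_bounded (M := M) (isCompact_closedBall _ _).measure_lt_top.ne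
      hm.aestronglyMeasurable (.of_forall fun x => by
        rw [Real.norm_of_nonneg (h0 x)]; exact hM x)
  refine (integrableOn_iff_integrable_of_support_subset fun x hx => ?_).1 this
  by_contra hx'
  exact hx (hs x hx')

omit [BorelSpace V] in
theorem IsSpreadDensity.integrable {f : V → ℝ} (hf : IsSpreadDensity μ h F n₀ f) :
    Integrable f μ := by
  obtain ⟨M, hM⟩ := hf.bdd
  exact integrable_of_bdd_of_support hf.measurable hf.nonneg hM hf.support

theorem setIntegral_ball_le {f : V → ℝ} (hi : Integrable f μ) {M : ℝ}
    (hM : ∀ x, f x ≤ M) (y : V) (n : ℕ) :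
    ∫ x in Metric.ball y (4 * 2⁻¹ ^ n), f x ∂μ ≤
      M * 4 ^ Module.finrank ℝ V * μ.real (Metric.ball 0 1) *
        (2⁻¹ ^ n) ^ Module.finrank ℝ V := by
  have h1 : ∫ x in Metric.ball y (4 * 2⁻¹ ^ n), f x ∂μ ≤
      ∫ x in Metric.ball y (4 * 2⁻¹ ^ n), M ∂μ :=
    integral_mono hi.integrableOn (integrableOn_const Metric.isBounded_ball.measure_lt_top.ne) hM
  rw [setIntegral_const, smul_eq_mul, measureReal_def,
    Measure.addHaar_ball_of_pos μ y (by positivity), ENNReal.toReal_mul,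
    ENNReal.toReal_ofReal (by positivity), ← measureReal_def] at h1
  refine h1.trans_eq ?_
  rw [mul_pow]
  ring

theorem exists_isSpreadDensity (hh : DominatesPow h (Module.finrank ℝ V)) (F : ℕ → Set V) :
    ∃ n₀, IsSpreadDensity μ h F n₀ ((Metric.closedBall (0 : V) 1).indicator 1) := by
  obtain ⟨n₀, hn₀⟩ := eventually_atTop.1
    (hh (1 * 4 ^ Module.finrank ℝ V * μ.real (Metric.ball (0 : V) 1)))
  have hK : MeasurableSet (Metric.closedBall (0 : V) 1) := Metric.isClosed_closedBall.measurableSet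
  have hM : ∀ x, (Metric.closedBall (0 : V) 1).indicator (1 : V → ℝ) x ≤ 1 := fun x =>
    Set.indicator_le_self' (fun _ _ => zero_le_one) x
  have h0 : ∀ x, 0 ≤ (Metric.closedBall (0 : V) 1).indicator (1 : V → ℝ) x := fun x =>
    Set.indicator_nonneg (fun _ _ => zero_le_one) x
  have hs : ∀ x ∉ Metric.closedBall (0 : V) 1,
      (Metric.closedBall (0 : V) 1).indicator (1 : V → ℝ) x = 0 := fun x hx =>
    Set.indicator_of_notMem hx _
  have hm : Measurable ((Metric.closedBall (0 : V) 1).indicator (1 : V → ℝ)) :=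
    measurable_one.indicator hK
  refine ⟨n₀, hm, h0, ⟨1, hM⟩, hs, ?_, fun n hn y _ => ?_⟩
  · rw [integral_indicator_one hK]
    have : 0 < μ.real (Metric.closedBall (0 : V) 1) :=
      ENNReal.toReal_pos (Metric.measure_closedBall_pos μ 0 one_pos).ne'
        Metric.isBounded_closedBall.measure_lt_top.ne
    linarith
  · exact (setIntegral_ball_le (integrable_of_bdd_of_support hm h0 hM hs) hM y n).trans_lt
      (hn₀ n hn)

/-- Only finitely many strict inequalities are at stake: the mass, and the balls of scale `n₀ ≤ n <
n₁` centred in the finite `F n`. Weak convergence preserves them for large `N`. From scale `n₁` on,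
the uniform bound `M * K` is enough for every `N`. -/
theorem IsSpreadDensity.exists_thinning (hh : DominatesPow h (Module.finrank ℝ V))
    (hF : ∀ n, (F n).Finite) {f : V → ℝ} (hf : IsSpreadDensity μ h F n₀ f) {T : ℕ → Set V}
    (hT : Thinnable μ T) :
    ∃ N f', IsSpreadDensity μ h F n₀ f' ∧ ∀ x, f' x ≠ 0 → f x ≠ 0 ∧ x ∈ T N := by
  obtain ⟨K, w, hwm, hw0, hwK, hwT, hw⟩ := hT
  obtain ⟨M, hM⟩ := hf.bdd
  have hm : ∀ N, Measurable fun x => f x * w N x := fun N => hf.measurable.mul (hwm N)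
  have h0 : ∀ N x, 0 ≤ f x * w N x := fun N x => mul_nonneg (hf.nonneg x) (hw0 N x)
  have hMK : ∀ N x, f x * w N x ≤ M * K := fun N x =>
    mul_le_mul (hM x) (hwK N x) (hw0 N x) ((hf.nonneg x).trans (hM x))
  have hs : ∀ N, ∀ x ∉ Metric.closedBall (0 : V) 1, f x * w N x = 0 := fun N x hx => by
    rw [hf.support x hx, zero_mul]
  obtain ⟨n₁, hn₁⟩ := eventually_atTop.1
    (hh (M * K * 4 ^ Module.finrank ℝ V * μ.real (Metric.ball (0 : V) 1)))
  have hmass := (hw f hf.integrable).eventually_const_lt hf.mass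
  have hball : ∀ᶠ N in atTop, ∀ n ∈ Set.Ico n₀ n₁, ∀ y ∈ F n,
      ∫ x in Metric.ball y (4 * 2⁻¹ ^ n), f x * w N x ∂μ < h (2⁻¹ ^ n) := by
    refine (eventually_all_finite (Set.finite_Ico n₀ n₁)).2 fun n hn =>
      (eventually_all_finite (hF n)).2 fun y hy => ?_
    have h1 := hw ((Metric.ball y (4 * 2⁻¹ ^ n)).indicator f)
      (hf.integrable.indicator measurableSet_ball)
    rw [integral_indicator measurableSet_ball] at h1
    filter_upwards [h1.eventually_lt_const (hf.ball n hn.1 y hy)] with N hN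
    rw [← integral_indicator measurableSet_ball]
    simpa only [Set.indicator_mul_left] using hN
  obtain ⟨N, hN1, hN2⟩ := (hmass.and hball).exists
  refine ⟨N, fun x => f x * w N x, ⟨hm N, h0 N, ⟨M * K, hMK N⟩, hs N, hN1, fun n hn y hy => ?_⟩,
    fun x hx => ⟨left_ne_zero_of_mul hx, ?_⟩⟩
  · by_cases hnn : n < n₁
    · exact hN2 n ⟨hn, hnn⟩ y hy
    · exact (setIntegral_ball_le (integrable_of_bdd_of_support (hm N) (h0 N) (hMK N) (hs N))
        (hMK N) y n).trans_lt (hn₁ n (not_lt.1 hnn))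
  · by_contra hxT
    exact hx (mul_eq_zero_of_right _ (hwT N x hxT))

omit [BorelSpace V] in
/-- A set that is a decreasing intersection of compact sets carrying spread densities has positive
Hausdorff measure. -/
theorem hausdorffOuter_pos_of_isSpreadDensity (hmono : Monotone h)
    (hF : ∀ n, ∀ x ∈ Metric.closedBall (0 : V) 1, ∃ y ∈ F n, dist x y < 2⁻¹ ^ n)
    {E : ℕ → Set V} (hE : ∀ j, IsCompact (E j)) (hanti : Antitone E)
    (hEK : ∀ j, E j ⊆ Metric.closedBall 0 1) {f : ℕ → V → ℝ}
    (hf : ∀ j, IsSpreadDensity μ h F n₀ (f j)) (hfE : ∀ j, ∀ x ∉ E j, f j x = 0) :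
    0 < hausdorffOuter h (⋂ j, E j) := by
  set c : ℝ := μ.real (Metric.closedBall (0 : V) 1) / 2
  have hc : 0 < c := half_pos (ENNReal.toReal_pos (Metric.measure_closedBall_pos μ 0 one_pos).ne'
        Metric.isBounded_closedBall.measure_lt_top.ne)
  have hδ : (0 : ℝ≥0) < 2⁻¹ ^ n₀ := pow_pos (by norm_num) _
  refine (ENNReal.ofReal_pos.2 hc).trans_le (le_trans ?_ (le_iSup₂ (2⁻¹ ^ n₀ : ℝ≥0) hδ))
  refine le_iInf₂ fun U hU => ?_
  -- each covering set is replaced by an open ball, on which all densities have small mass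
  have hball : ∀ i, ∃ W : Set V, IsOpen W ∧ U i ∩ (⋂ j, E j) ⊆ W ∧
      ∀ j, ∫⁻ x in W, ENNReal.ofReal (f j x) ∂μ ≤ h (Metric.ediam (U i)).toNNReal := by
    intro i
    by_cases hne : (U i ∩ ⋂ j, E j).Nonempty
    swap
    · exact ⟨∅, isOpen_empty, by rw [Set.not_nonempty_iff_eq_empty.1 hne], by simp⟩
    obtain ⟨x, hxU, hxE⟩ := hne
    have hfin : Metric.ediam (U i) ≠ ∞ := ((hU.2 i).2.trans_lt ENNReal.coe_lt_top).ne
    set r : ℝ≥0 := (Metric.ediam (U i)).toNNReal with hr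
    have hrU : (r : ℝ≥0∞) = Metric.ediam (U i) := ENNReal.coe_toNNReal hfin
    have hr0 : 0 < r := by
      have := (hU.2 i).1
      rw [← hrU] at this
      exact_mod_cast this
    have hrδ : r ≤ 2⁻¹ ^ n₀ := by
      have := (hU.2 i).2
      rw [← hrU] at this
      exact_mod_cast this
    obtain ⟨n, hn1, hn2⟩ := exists_nat_pow_near_of_lt_one hr0
      -- Here `2⁻⁽ⁿ⁺¹⁾ < r ≤ 2⁻ⁿ`. A net point within `2⁻⁽ⁿ⁺¹⁾` of `x` is within `3 · 2⁻⁽ⁿ⁺¹⁾` of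
      -- every point of `U i`, so radius `4 · 2⁻⁽ⁿ⁺¹⁾` suffices, and `h (2⁻⁽ⁿ⁺¹⁾) ≤ h r`.
      (hrδ.trans (pow_le_one₀ zero_le (by norm_num))) (y := (2⁻¹ : ℝ≥0)) (by norm_num) (by norm_num)
    have hn : n₀ ≤ n + 1 :=
      ((pow_lt_pow_iff_right_of_lt_one₀ (by norm_num) (by norm_num)).1 (hn1.trans_le hrδ)).le
    obtain ⟨y, hy, hxy⟩ := hF (n + 1) x (hEK 0 (Set.mem_iInter.1 hxE 0))
    refine ⟨Metric.ball y (4 * 2⁻¹ ^ (n + 1)), Metric.isOpen_ball, fun z hz => ?_, fun j => ?_⟩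
    · have h1 : dist z x ≤ r := by
        have := Metric.edist_le_ediam_of_mem hz.1 hxU
        rw [← hrU, edist_nndist] at this
        exact_mod_cast this
      have h2 : (r : ℝ) ≤ 2⁻¹ ^ n := by exact_mod_cast hn2
      have h3 : (2⁻¹ : ℝ) ^ n = 2 * 2⁻¹ ^ (n + 1) := by rw [pow_succ]; ring
      have h4 : (0 : ℝ) < 2⁻¹ ^ (n + 1) := by positivity
      rw [Metric.mem_ball]
      linarith [dist_triangle z x y]
    · rw [← ofReal_integral_eq_lintegral_ofReal (hf j).integrable.integrableOn
        (.of_forall (hf j).nonneg)]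
      refine (ENNReal.ofReal_le_ofReal ((hf j).ball (n + 1) hn y hy).le).trans ?_
      rw [ENNReal.ofReal_coe_nnreal]
      exact_mod_cast hmono hn1.le
  choose W hWo hUW hW using hball
  -- By compactness the open cover of the intersection already covers some `E j`, which carries all
  -- the mass of `f j`; no limit measure is needed.
  obtain ⟨j, hj⟩ := exists_subset_nhds_of_isCompact (V := E) hanti.directed_ge hE
    (U := ⋃ i, W i) fun x hx => by
      obtain ⟨i, hi⟩ := Set.mem_iUnion.1 (hU.1 hx)
      exact (isOpen_iUnion hWo).mem_nhds (Set.mem_iUnion.2 ⟨i, hUW i ⟨hi, hx⟩⟩)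
  calc ENNReal.ofReal c ≤ ENNReal.ofReal (∫ x, f j x ∂μ) :=
        ENNReal.ofReal_le_ofReal (hf j).mass.le
    _ = ∫⁻ x, ENNReal.ofReal (f j x) ∂μ :=
        ofReal_integral_eq_lintegral_ofReal (hf j).integrable (.of_forall (hf j).nonneg)
    _ = ∫⁻ x in ⋃ i, W i, ENNReal.ofReal (f j x) ∂μ := by
        refine (setLIntegral_eq_of_support_subset ?_).symm
        intro x hx
        refine hj ?_
        by_contra hxE
        exact hx (by simp [hfE j x hxE])
    _ ≤ ∑' i, ∫⁻ x in W i, ENNReal.ofReal (f j x) ∂μ := lintegral_iUnion_le _ _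
    _ ≤ ∑' i, (h (Metric.ediam (U i)).toNNReal : ℝ≥0∞) := ENNReal.tsum_le_tsum fun i => hW i j

/-- For closed thinnable families `T j`, frequencies can be chosen such that the intersection of the
unit ball with all the `T j (N j)` has positive Hausdorff measure. -/
theorem exists_hausdorffOuter_pos (hmono : Monotone h)
    (hh : DominatesPow h (Module.finrank ℝ V)) (μ : Measure V) [μ.IsAddHaarMeasure]
    {T : ℕ → ℕ → Set V} (hTc : ∀ j N, IsClosed (T j N)) (hT : ∀ j, Thinnable μ (T j)) :
    ∃ N : ℕ → ℕ, ∃ E ⊆ ⋂ j, T j (N j), IsCompact E ∧ 0 < hausdorffOuter h E := by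
  have hnet : ∀ n : ℕ, ∃ F : Set V, F.Finite ∧
      ∀ x ∈ Metric.closedBall (0 : V) 1, ∃ y ∈ F, dist x y < 2⁻¹ ^ n := fun n => by
    obtain ⟨F, -, hF, hc⟩ := (isCompact_closedBall (0 : V) 1).finite_cover_balls
      (e := 2⁻¹ ^ n) (by positivity)
    exact ⟨F, hF, fun x hx => by simpa using hc hx⟩
  choose F hFf hF using hnet
  obtain ⟨n₀, h0⟩ := exists_isSpreadDensity (μ := μ) hh F
  have step : ∀ (j : ℕ) (f : {f : V → ℝ // IsSpreadDensity μ h F n₀ f}),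
      ∃ (N : ℕ) (f' : {f : V → ℝ // IsSpreadDensity μ h F n₀ f}),
        ∀ x, f'.1 x ≠ 0 → f.1 x ≠ 0 ∧ x ∈ T j N := fun j f => by
    obtain ⟨N, f', hf', hs⟩ := f.2.exists_thinning hh hFf (hT j)
    exact ⟨N, ⟨f', hf'⟩, hs⟩
  choose N f' hf' using step
  let f : ℕ → {f : V → ℝ // IsSpreadDensity μ h F n₀ f} := fun j => Nat.rec ⟨_, h0⟩ f' j
  let E : ℕ → Set V := fun j => Metric.closedBall 0 1 ∩ ⋂ i < j, T i (N i (f i))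
  have hE : ∀ j, IsCompact (E j) := fun j => (isCompact_closedBall _ _).inter_right
    (isClosed_biInter fun i _ => hTc i _)
  refine ⟨fun j => N j (f j), ⋂ j, E j, fun x hx => ?_, ?_, ?_⟩
  · refine Set.mem_iInter.2 fun j => ?_
    exact Set.mem_iInter₂.1 (Set.mem_iInter.1 hx (j + 1)).2 j j.lt_succ_self
  · exact (hE 0).of_isClosed_subset (isClosed_iInter fun j => (hE j).isClosed)
      (Set.iInter_subset _ 0)
  · refine hausdorffOuter_pos_of_isSpreadDensity (f := fun j => (f j).1) hmono hF hE ?_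
      (fun j => Set.inter_subset_left) (fun j => (f j).2) fun j x hx => ?_
    · intro i j hij
      exact Set.inter_subset_inter_right _
        (Set.biInter_subset_biInter_left fun k (hk : k < i) => hk.trans_le hij)
    · by_contra hne
      refine hx ⟨by_contra fun hx' => hne ((f j).2.support x hx'), ?_⟩
      clear hx
      induction j with
      | zero => simp
      | succ j ih =>
        obtain ⟨h1, h2⟩ := hf' j (f j) x hne
        refine Set.mem_iInter₂.2 fun i hi => ?_
        rcases Nat.lt_succ_iff_lt_or_eq.1 hi with hi | rfl
        · exact Set.mem_iInter₂.1 (ih h1) i hi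
        · exact h2

end Construction

end LinearPatterns

/-! ### Scalar and vector patterns, and the choice of constraints -/

namespace LinearPatterns

open MeasureTheory

theorem VectorAvoidance.scalarAvoidance {d : ℕ} {h : ℝ≥0 → ℝ≥0} (H : VectorAvoidance d h) :
    ScalarAvoidance d h := by
  intro m ψ hm hψ
  let e : ℝ ≃ₗ[ℝ] EuclideanSpace ℝ (Fin 1) :=
    (LinearEquiv.funUnique (Fin 1) ℝ ℝ).symm.trans (WithLp.linearEquiv 2 ℝ (Fin 1 → ℝ)).symm
  obtain ⟨E, hE, hpos, hav⟩ := H m (fun _ => 1) (fun k => e.toLinearMap ∘ₗ ψ k) hm fun k h0 =>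
    hψ k (LinearMap.ext fun x => e.map_eq_zero_iff.1 (LinearMap.congr_fun h0 x))
  refine ⟨E, hE, hpos, fun k ⟨x, hx, hxE, h0⟩ => hav k ⟨x, hx, hxE, ?_⟩⟩
  simp [h0]

theorem ScalarAvoidance.vectorAvoidance {d : ℕ} {h : ℝ≥0 → ℝ≥0} (H : ScalarAvoidance d h) :
    VectorAvoidance d h := by
  intro m N ψ hm hψ
  have hcomp : ∀ k, ∃ i, (EuclideanSpace.proj (𝕜 := ℝ) i).toLinearMap ∘ₗ ψ k ≠ 0 := fun k => by
    by_contra! h0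
    exact hψ k (LinearMap.ext fun x => PiLp.ext fun i => LinearMap.congr_fun (h0 i) x)
  choose i hi using hcomp
  obtain ⟨E, hE, hpos, hav⟩ := H m (fun k => (EuclideanSpace.proj (i k)).toLinearMap ∘ₗ ψ k) hm hi
  refine ⟨E, hE, hpos, fun k ⟨x, hx, hxE, h0⟩ => hav k ⟨x, hx, hxE, ?_⟩⟩
  simp [h0]

/-- Distinct points can be separated by members of any basis. -/
theorem exists_pairwise_disjoint_basis {X ι : Type*} [TopologicalSpace X] [T2Space X] [Finite ι]
    {b : Set (Set X)} (hb : TopologicalSpace.IsTopologicalBasis b) {x : ι → X}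
    (hx : Function.Injective x) :
    ∃ B : ι → Set X, (∀ i, B i ∈ b ∧ x i ∈ B i) ∧ Pairwise (Function.onFun Disjoint B) := by
  have hd : Pairwise (Function.onFun Disjoint fun i => 𝓝 (x i)) := fun i j hij =>
    pairwise_disjoint_nhds (hx.ne hij)
  exact hd.exists_mem_filter_basis_of_disjoint fun i => hb.nhds_hasBasis

/-- A compact set of positive Hausdorff measure without non-trivial coincidences
`∑ i, a k i (x i) = 0`, for countably many non-zero families of functionals `a k`. -/
theorem exists_hausdorffOuter_pos_sum_ne_zero {V : Type*} [NormedAddCommGroup V] [NormedSpace ℝ V]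
    [FiniteDimensional ℝ V] [MeasurableSpace V] [BorelSpace V] (μ : Measure V)
    [μ.IsAddHaarMeasure] {h : ℝ≥0 → ℝ≥0} (hmono : Monotone h)
    (hh : DominatesPow h (Module.finrank ℝ V)) {m : ℕ → ℕ} (a : ∀ k, Fin (m k) → V →L[ℝ] ℝ)
    (ha : ∀ k, ∃ i, a k i ≠ 0) :
    ∃ E : Set V, IsCompact E ∧ 0 < hausdorffOuter h E ∧
      ∀ k, ∀ x : Fin (m k) → V, Function.Injective x → (∀ i, x i ∈ E) → ∑ i, a k i (x i) ≠ 0 := by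
  have : SecondCountableTopology V := secondCountable_of_proper
  choose i₀ hi₀ using ha
  -- The whole shift `1/2` sits on an index with non-zero functional; `m k * η k = 1/4` leaves room
  -- below `1/2`.
  let s : ∀ k, Fin (m k) → UnitAddCircle := fun k => Pi.single (i₀ k) ((1 / 2 : ℝ) : UnitAddCircle)
  let η : ℕ → ℝ := fun k => 1 / (4 * m k)
  have hm0 : ∀ k, (0 : ℝ) < m k := fun k => Nat.cast_pos.2 ((i₀ k).pos)
  have hη : ∀ k, 0 < η k := fun k => one_div_pos.2 (mul_pos four_pos (hm0 k))
  have hs : ∀ k i, a k i = 0 → s k i = 0 := fun k i hi => by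
    have hne : i ≠ i₀ k := fun h => hi₀ k (h ▸ hi)
    simp only [s, Pi.single_apply, if_neg hne]
  -- Adding `∅` makes the index type `I` non-empty, so that it can be enumerated by `ℕ`.
  let b : Set (Set V) := insert ∅ (TopologicalSpace.countableBasis V)
  have hbo : ∀ B ∈ b, IsOpen B := by
    rintro B (rfl | hB)
    · exact isOpen_empty
    · exact TopologicalSpace.isOpen_of_mem_countableBasis hB
  have : Countable b := ((TopologicalSpace.countable_countableBasis V).insert ∅).to_subtype
  let I := Σ k, {B : Fin (m k) → b // Pairwise (Function.onFun Disjoint fun i => (B i : Set V))}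
  have : Nonempty I :=
    ⟨0, fun _ => ⟨∅, Set.mem_insert _ _⟩, fun _ _ _ => Set.disjoint_empty _⟩
  obtain ⟨e, he⟩ := exists_surjective_nat I
  let T : I → ℕ → Set V := fun t => gridSet (fun i => (t.2.1 i : Set V)) (a t.1) (s t.1) (η t.1)
  have hTc : ∀ t N, IsClosed (T t N) := fun t N =>
    isClosed_gridSet (fun i => hbo _ (t.2.1 i).2) _ _ _ _
  have hTt : ∀ t, Thinnable μ (T t) := fun t =>
    thinnable_gridSet μ (fun i => hbo _ (t.2.1 i).2) t.2.2
      (hs t.1) (hη t.1)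
  obtain ⟨N, E, hET, hE, hpos⟩ := exists_hausdorffOuter_pos (T := fun j => T (e j))
    hmono hh μ (fun j => hTc (e j)) (fun j => hTt (e j))
  refine ⟨E, hE, hpos, fun k x hx hxE => ?_⟩
  obtain ⟨B, hB, hBd⟩ := exists_pairwise_disjoint_basis
    (TopologicalSpace.isBasis_countableBasis V) hx
  obtain ⟨j, hj⟩ := he ⟨k, fun i => ⟨B i, Set.mem_insert_of_mem _ (hB i).1⟩, hBd⟩
  have hxT : ∀ i, x i ∈ gridSet B (a k) (s k) (η k) (N j) := fun i => by
    have := Set.mem_iInter.1 (hET (hxE i)) j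
    rw [hj] at this
    exact this
  refine sum_ne_zero_of_mem_gridSet ?_ ?_ (fun i => (hB i).2) hxT
  · simp [s]
  · have := hm0 k
    simp only [Fintype.card_fin, η]
    field_simp
    norm_num

theorem scalarAvoidance_of_prec {d : ℕ} {h : ℝ≥0 → ℝ≥0} (hh : IsDimensionFunction h)
    (hp : Prec h fun x => x ^ d) : ScalarAvoidance d h := by
  intro m ψ _ hψ
  let a : ∀ k, Fin (m k) → EuclideanSpace ℝ (Fin d) →L[ℝ] ℝ := fun k i =>
    LinearMap.toContinuousLinearMap
      (ψ k ∘ₗ LinearMap.single ℝ (fun _ => EuclideanSpace ℝ (Fin d)) i)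
  have hψa : ∀ k x, ψ k x = ∑ i, a k i (x i) := fun k x => by
    conv_lhs => rw [← Finset.univ_sum_single x, map_sum]
    rfl
  have ha : ∀ k, ∃ i, a k i ≠ 0 := fun k => by
    by_contra! h0
    exact hψ k (LinearMap.ext fun x => by simp [hψa, h0])
  obtain ⟨E, hE, hpos, hav⟩ := exists_hausdorffOuter_pos_sum_ne_zero volume hh.mono
    (by rw [finrank_euclideanSpace_fin]; exact DominatesPow.of_prec hh.pos hp) a ha
  exact ⟨E, hE, hpos, fun k ⟨x, hx, hxE, h0⟩ => hav k x hx hxE ((hψa k x).symm.trans h0)⟩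

end LinearPatterns

theorem mainTheorem6 (d : ℕ) (hd : 1 ≤ d) (h : ℝ≥0 → ℝ≥0)
    (hh : LinearPatterns.IsDimensionFunction h) :
    (LinearPatterns.Prec h (fun x => x ^ d) → LinearPatterns.VectorAvoidance d h) ∧
      (LinearPatterns.VectorAvoidance d h ↔ LinearPatterns.ScalarAvoidance d h) :=
  ⟨fun hp => (LinearPatterns.scalarAvoidance_of_prec hh hp).vectorAvoidance,
    LinearPatterns.VectorAvoidance.scalarAvoidance, LinearPatterns.ScalarAvoidance.vectorAvoidance⟩
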